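/- Let $\rho,\sigma$ be density matrices on a finite-dimensional complex Hilbert space (positive semidefinite, trace one) with the same spectrum, i.e. the same eigenvalues with the same multiplicities. Define the quantum charging distance $D(\rho,\sigma)$ as the infimum of all $T\ge 0$ for which there is a (possibly time-dependent, measurable) Hermitian $V_t$, $t\in[0,T]$, with operator norm $\|V_t\|=1$ for all $t$, such that $\sigma=U\rho U^\dagger$, where $U=\mathrm{Texp}\left(-i\int_0^T V_t\,dt\right)$, that is, $U=U_T$ for the solution of $U_t=I-i\int_0^t V_sU_s\,ds$ on $[0,T]$. Let $F(\rho,\sigma)=\mathrm{tr}\sqrt{\sqrt{\rho}\,\sigma\sqrt{\rho}}$ be Uhlmann's fidelity and $\theta_B(\rho,\sigma)=\arccos F(\rho,\sigma)$ the Bures angle. Then $$\theta_B(\rho,\sigma)\le D(\rho,\sigma).$$ -/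

import Mathlib

namespace QuantumCharging

section States

open scoped ComplexOrder

/-- A density matrix: a positive semidefinite complex matrix of trace one. -/
structure IsDensityMatrix {n : Type*} [Fintype n] (ρ : Matrix n n ℂ) : Prop where
  posSemidef : ρ.PosSemidef
  trace_eq_one : ρ.trace = 1

/-- Two matrices have the same spectrum: the same eigenvalues with the same
(algebraic) multiplicities. -/
def SameSpectrum {n : Type*} [Fintype n] [DecidableEq n] (ρ σ : Matrix n n ℂ) : Prop :=
  ρ.charpoly.roots = σ.charpoly.roots

end States

section Fidelity

open scoped MatrixOrder

/-- Uhlmann's fidelity `tr √(√ρ σ √ρ)`, with positive semidefinite square roots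
(the trace of a positive semidefinite matrix is real). -/
noncomputable def fidelity {n : Type*} [Fintype n] [DecidableEq n] (ρ σ : Matrix n n ℂ) : ℝ :=
  (CFC.sqrt (CFC.sqrt ρ * σ * CFC.sqrt ρ)).trace.re

/-- The Bures angle `arccos F(ρ, σ)`. -/
noncomputable def buresAngle {n : Type*} [Fintype n] [DecidableEq n] (ρ σ : Matrix n n ℂ) : ℝ :=
  Real.arccos (fidelity ρ σ)

end Fidelity

section Charging

open MeasureTheory
open scoped Matrix.Norms.L2Operator

/-- A charging Hamiltonian on `[0, T]`: a measurable, time-dependent Hermitian matrix whose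
operator norm (the `ℓ²` operator norm) is one at all times. -/
structure IsChargingHamiltonian {n : Type*} [Fintype n] [DecidableEq n] (T : ℝ)
    (V : ℝ → Matrix n n ℂ) : Prop where
  aestronglyMeasurable : AEStronglyMeasurable V (volume.restrict (Set.Icc 0 T))
  isHermitian : ∀ t ∈ Set.Icc 0 T, (V t).IsHermitian
  norm_eq_one : ∀ t ∈ Set.Icc 0 T, ‖V t‖ = 1

/-- `U t = Texp (-i ∫₀ᵗ V s ds)` for all `t ∈ [0, T]`: the time-ordered exponential is the
continuous solution of the Schrödinger equation `U' = -i V U`, `U 0 = 1`, in integral form. -/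
structure IsPropagator {n : Type*} [Fintype n] [DecidableEq n] (T : ℝ)
    (V U : ℝ → Matrix n n ℂ) : Prop where
  continuousOn : ContinuousOn U (Set.Icc 0 T)
  eq_integral : ∀ t ∈ Set.Icc 0 T, U t = 1 - Complex.I • ∫ s in (0 : ℝ)..t, V s * U s

/-- The durations `T ≥ 0` in which some charging Hamiltonian drives `ρ` to `σ`. -/
def chargingTimes {n : Type*} [Fintype n] [DecidableEq n] (ρ σ : Matrix n n ℂ) : Set ℝ :=
  {T | 0 ≤ T ∧ ∃ V U : ℝ → Matrix n n ℂ, IsChargingHamiltonian T V ∧ IsPropagator T V U ∧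
    σ = U T * ρ * (U T).conjTranspose}

/-- The quantum charging distance: the minimal duration in which some charging Hamiltonian
drives `ρ` to `σ`. -/
noncomputable def chargingDistance {n : Type*} [Fintype n] [DecidableEq n]
    (ρ σ : Matrix n n ℂ) : ℝ :=
  sInf (chargingTimes ρ σ)

end Charging

end QuantumCharging

open MeasureTheory Set Filter Topology
namespace QuantumCharging

/-! For a unit vector `v`, the curve `U t v` stays on the unit sphere and has speed at most `‖V t‖ =
1`, so it sweeps a real angle of at most `T`; hence `Re ⟨v, U T v⟩ ≥ cos T` for `T ≤ π`
(`cos_le_re_inner_propagator`). Averaging over an eigenbasis of `ρ` gives `Re tr (ρ U) ≥ cos T`. The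
fidelity of `ρ` and `U ρ U†` is the trace norm of `√ρ U† √ρ`, which dominates `Re tr (ρ U)`
(`re_trace_mul_le_fidelity`). So the Bures angle is at most every charging time. The infimum
inherits this bound only if some charging time exists, since `sInf ∅ = 0` in `ℝ`; equality of
spectra enters there (`chargingTimes_nonempty`). -/

theorem eq_of_norm_sub_le_mul_sq {E : Type*} [NormedAddCommGroup E] [NormedSpace ℝ E]
    {f : ℝ → E} {a b C : ℝ}
    (hf : ∀ s ∈ Icc a b, ∀ t ∈ Icc a b, s ≤ t → ‖f t - f s‖ ≤ C * (t - s) ^ 2) :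
    ∀ t ∈ Icc a b, f t = f a := by
  have hsym : ∀ s ∈ Icc a b, ∀ t ∈ Icc a b, ‖f t - f s‖ ≤ C * (t - s) ^ 2 := by
    intro s hs t ht
    rcases le_total s t with h | h
    · exact hf s hs t ht h
    · rw [norm_sub_rev]
      convert hf t ht s hs h using 2
      ring
  have hd : ∀ s ∈ Icc a b, HasDerivWithinAt f 0 (Icc a b) s := by
    intro s hs
    rw [hasDerivWithinAt_iff_isLittleO]
    have h1 : (fun t => f t - f s - (t - s) • (0 : E)) =O[𝓝[Icc a b] s]
        fun t => (t - s) ^ 2 := by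
      refine Asymptotics.IsBigO.of_bound C ?_
      filter_upwards [self_mem_nhdsWithin] with t ht
      simpa using hsym s hs t ht
    refine h1.trans_isLittleO ?_
    have h2 : (fun t : ℝ => (t - s) ^ 2) =o[𝓝 s] fun t => (t - s) := by
      have h3 : Tendsto (fun t : ℝ => t - s) (𝓝 s) (𝓝 0) := by
        have : Continuous fun t : ℝ => t - s := by fun_prop
        simpa using this.tendsto s
      simpa [Function.comp_def] using
        (Asymptotics.isLittleO_pow_id (𝕜 := ℝ) (n := 2) (by norm_num)).comp_tendsto h3
    exact h2.mono nhdsWithin_le_nhds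
  refine constant_of_derivWithin_zero (fun s hs => (hd s hs).differentiableWithinAt) ?_
  intro s hs
  refine (hd s (Ico_subset_Icc_self hs)).derivWithin ?_
  exact uniqueDiffOn_Icc (lt_of_le_of_lt hs.1 hs.2) s (Ico_subset_Icc_self hs)

/-! ### Propagators of measurable Hamiltonians: unitarity and Lipschitz bound. -/

section Propagator

variable {A : Type*} [CStarAlgebra A] {T : ℝ} {V U : ℝ → A}

theorem intervalIntegrable_of_norm_le_one
    (hV : AEStronglyMeasurable V (volume.restrict (Icc 0 T)))
    (hV1 : ∀ t ∈ Icc 0 T, ‖V t‖ ≤ 1) {s t : ℝ} (hs : s ∈ Icc 0 T) (ht : t ∈ Icc 0 T) :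
    IntervalIntegrable V volume s t := by
  have h : IntegrableOn V (Icc 0 T) := by
    refine Integrable.mono' (g := fun _ => (1 : ℝ)) (by simp) hV ?_
    exact (ae_restrict_iff' measurableSet_Icc).2 (.of_forall hV1)
  exact (h.mono_set ((ordConnected_Icc.uIcc_subset hs ht))).intervalIntegrable

theorem intervalIntegrable_mul_continuousOn
    (hV : AEStronglyMeasurable V (volume.restrict (Icc 0 T)))
    (hV1 : ∀ t ∈ Icc 0 T, ‖V t‖ ≤ 1) (hU : ContinuousOn U (Icc 0 T))
    {s t : ℝ} (hs : s ∈ Icc 0 T) (ht : t ∈ Icc 0 T) :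
    IntervalIntegrable (fun r => V r * U r) volume s t :=
  (intervalIntegrable_of_norm_le_one hV hV1 hs ht).mul_continuousOn
    (hU.mono (ordConnected_Icc.uIcc_subset hs ht))

theorem sub_eq_neg_I_smul_integral
    (hV : AEStronglyMeasurable V (volume.restrict (Icc 0 T)))
    (hV1 : ∀ t ∈ Icc 0 T, ‖V t‖ ≤ 1) (hU : ContinuousOn U (Icc 0 T))
    (hint : ∀ t ∈ Icc 0 T, U t = 1 - Complex.I • ∫ s in (0 : ℝ)..t, V s * U s)
    {s t : ℝ} (hs : s ∈ Icc 0 T) (ht : t ∈ Icc 0 T) :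
    U t - U s = -(Complex.I • ∫ r in s..t, V r * U r) := by
  have h0 : (0 : ℝ) ∈ Icc 0 T := ⟨le_rfl, hs.1.trans hs.2⟩
  rw [hint t ht, hint s hs, ← intervalIntegral.integral_interval_sub_left
    (intervalIntegrable_mul_continuousOn hV hV1 hU h0 ht)
    (intervalIntegrable_mul_continuousOn hV hV1 hU h0 hs), smul_sub]
  abel

theorem norm_sub_le_mul_of_norm_le {C : ℝ}
    (hV : AEStronglyMeasurable V (volume.restrict (Icc 0 T)))
    (hV1 : ∀ t ∈ Icc 0 T, ‖V t‖ ≤ 1) (hU : ContinuousOn U (Icc 0 T))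
    (hint : ∀ t ∈ Icc 0 T, U t = 1 - Complex.I • ∫ s in (0 : ℝ)..t, V s * U s)
    (hC : ∀ t ∈ Icc 0 T, ‖U t‖ ≤ C)
    {s t : ℝ} (hs : s ∈ Icc 0 T) (ht : t ∈ Icc 0 T) :
    ‖U t - U s‖ ≤ C * |t - s| := by
  rw [sub_eq_neg_I_smul_integral hV hV1 hU hint hs ht, norm_neg, norm_smul, Complex.norm_I,
    one_mul]
  refine intervalIntegral.norm_integral_le_of_norm_le_const fun r hr => ?_
  have hr' : r ∈ Icc 0 T := ordConnected_Icc.uIcc_subset hs ht (uIoc_subset_uIcc hr)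
  calc ‖V r * U r‖ ≤ ‖V r‖ * ‖U r‖ := norm_mul_le _ _
    _ ≤ 1 * C := mul_le_mul (hV1 r hr') (hC r hr') (norm_nonneg _) zero_le_one
    _ = C := one_mul C

/-- As `V` is only measurable, `U` need not be differentiable everywhere, and `U* U` cannot simply
be differentiated. Instead its increments are shown to be quadratic: the first-order terms `∓i U s*
Y U s`, with `Y = ∫ V` self-adjoint, cancel. `eq_of_norm_sub_le_mul_sq` then makes `U* U` constant.
-/
theorem norm_star_mul_self_sub_le {C : ℝ}
    (hV : AEStronglyMeasurable V (volume.restrict (Icc 0 T)))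
    (hV1 : ∀ t ∈ Icc 0 T, ‖V t‖ ≤ 1) (hVs : ∀ t ∈ Icc 0 T, star (V t) = V t)
    (hU : ContinuousOn U (Icc 0 T))
    (hint : ∀ t ∈ Icc 0 T, U t = 1 - Complex.I • ∫ s in (0 : ℝ)..t, V s * U s)
    (hC : ∀ t ∈ Icc 0 T, ‖U t‖ ≤ C)
    {s t : ℝ} (hs : s ∈ Icc 0 T) (ht : t ∈ Icc 0 T) (hst : s ≤ t) :
    ‖star (U t) * U t - star (U s) * U s‖ ≤ (3 * C ^ 2) * (t - s) ^ 2 := by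
  have hC0 : 0 ≤ C := (norm_nonneg _).trans (hC s hs)
  set Y : A := ∫ r in s..t, V r with hY
  -- The error of freezing `U r` at `U s`; it is of second order because `U` is Lipschitz.
  set R : A := ∫ r in s..t, V r * (U r - U s) with hR
  have hsub : uIcc s t ⊆ Icc 0 T := ordConnected_Icc.uIcc_subset hs ht
  have hi := intervalIntegrable_of_norm_le_one hV hV1 hs ht
  have hX : U t - U s = -(Complex.I • (Y * U s)) - Complex.I • R := by
    have h1 : R = (∫ r in s..t, V r * U r) - Y * U s := by
      have h2 : ∫ r in s..t, V r * U s = Y * U s :=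
        ((ContinuousLinearMap.mul ℝ A).flip (U s)).intervalIntegral_comp_comm hi
      rw [hR, ← h2, ← intervalIntegral.integral_sub
        (intervalIntegrable_mul_continuousOn hV hV1 hU hs ht)
        (hi.mul_continuousOn continuousOn_const)]
      simp only [mul_sub]
    rw [sub_eq_neg_I_smul_integral hV hV1 hU hint hs ht, h1, smul_sub]
    abel
  have hYs : star Y = Y := by
    have h1 : star Y = ∫ r in s..t, star (V r) :=
      ((starL' ℝ (A := A)).toContinuousLinearMap.intervalIntegral_comp_comm hi).symm
    rw [h1, hY]
    exact intervalIntegral.integral_congr fun r hr => hVs r (hsub hr)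
  have hRn : ‖R‖ ≤ C * (t - s) ^ 2 := by
    have h1 : ‖R‖ ≤ C * |t - s| * |t - s| := by
      refine intervalIntegral.norm_integral_le_of_norm_le_const fun r hr => ?_
      have hr' : r ∈ Icc 0 T := hsub (uIoc_subset_uIcc hr)
      have h2 := norm_sub_le_mul_of_norm_le hV hV1 hU hint hC hs hr'
      have h3 : |r - s| ≤ |t - s| := by
        rw [uIoc_of_le hst] at hr
        exact abs_le_abs_of_nonneg (by linarith [hr.1]) (by linarith [hr.2])
      calc ‖V r * (U r - U s)‖ ≤ ‖V r‖ * ‖U r - U s‖ := norm_mul_le _ _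
        _ ≤ 1 * (C * |t - s|) := mul_le_mul (hV1 r hr')
            (h2.trans (mul_le_mul_of_nonneg_left h3 hC0)) (norm_nonneg _) zero_le_one
        _ = C * |t - s| := one_mul _
    calc ‖R‖ ≤ C * |t - s| * |t - s| := h1
      _ = C * (t - s) ^ 2 := by rw [mul_assoc, abs_mul_abs_self]; ring
  have hXn := norm_sub_le_mul_of_norm_le hV hV1 hU hint hC hs ht
  have key : star (U t) * U t - star (U s) * U s =
      star (U t - U s) * (U t - U s) + Complex.I • (star R * U s) - Complex.I • (star (U s) * R) := by
    have h1 : U t = U s + (U t - U s) := by abel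
    have h2 : star (U t - U s) * U s + star (U s) * (U t - U s) =
        Complex.I • (star R * U s) - Complex.I • (star (U s) * R) := by
      rw [hX]
      simp only [star_sub, star_neg, star_smul, star_mul, hYs, RCLike.star_def, Complex.conj_I,
        sub_mul, mul_sub, neg_mul, mul_neg, smul_mul_assoc, mul_smul_comm, neg_smul, mul_assoc]
      abel
    rw [add_sub_assoc, ← h2]
    simp only [star_sub, sub_mul, mul_sub]
    abel
  rw [key]
  have n1 : ‖star (U t - U s) * (U t - U s)‖ ≤ C ^ 2 * (t - s) ^ 2 := by
    rw [CStarRing.norm_star_mul_self]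
    calc ‖U t - U s‖ * ‖U t - U s‖ ≤ (C * |t - s|) * (C * |t - s|) :=
          mul_le_mul hXn hXn (norm_nonneg _) (by positivity)
      _ = C ^ 2 * (|t - s| * |t - s|) := by ring
      _ = _ := by rw [abs_mul_abs_self]; ring
  have n2 : ‖Complex.I • (star R * U s)‖ ≤ C ^ 2 * (t - s) ^ 2 := by
    rw [norm_smul, Complex.norm_I, one_mul]
    calc ‖star R * U s‖ ≤ ‖R‖ * ‖U s‖ := by simpa using norm_mul_le (star R) (U s)
      _ ≤ (C * (t - s) ^ 2) * C := mul_le_mul hRn (hC s hs) (norm_nonneg _) (by positivity)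
      _ = _ := by ring
  have n3 : ‖Complex.I • (star (U s) * R)‖ ≤ C ^ 2 * (t - s) ^ 2 := by
    rw [norm_smul, Complex.norm_I, one_mul]
    calc ‖star (U s) * R‖ ≤ ‖U s‖ * ‖R‖ := by simpa using norm_mul_le (star (U s)) R
      _ ≤ C * (C * (t - s) ^ 2) := mul_le_mul (hC s hs) hRn (norm_nonneg _) hC0
      _ = _ := by ring
  refine (norm_sub_le _ _).trans ?_
  have := norm_add_le (star (U t - U s) * (U t - U s)) (Complex.I • (star R * U s))
  linarith

theorem star_mul_self_eq_one_of_integral_eq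
    (hV : AEStronglyMeasurable V (volume.restrict (Icc 0 T)))
    (hV1 : ∀ t ∈ Icc 0 T, ‖V t‖ ≤ 1) (hVs : ∀ t ∈ Icc 0 T, star (V t) = V t)
    (hU : ContinuousOn U (Icc 0 T))
    (hint : ∀ t ∈ Icc 0 T, U t = 1 - Complex.I • ∫ s in (0 : ℝ)..t, V s * U s) :
    ∀ t ∈ Icc 0 T, star (U t) * U t = 1 := by
  intro t ht
  -- A crude a priori bound from compactness suffices; once unitarity is known, the Lipschitz
  -- constant improves to 1.
  obtain ⟨C, hC⟩ := isCompact_Icc.exists_bound_of_continuousOn hU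
  have h0 : U 0 = 1 := by simpa using hint 0 ⟨le_rfl, ht.1.trans ht.2⟩
  have := eq_of_norm_sub_le_mul_sq (f := fun t => star (U t) * U t) (C := 3 * C ^ 2)
    (fun s hs t ht hst => norm_star_mul_self_sub_le hV hV1 hVs hU hint hC hs ht hst) t ht
  simpa [h0] using this

theorem norm_sub_le_abs_sub_of_integral_eq
    (hV : AEStronglyMeasurable V (volume.restrict (Icc 0 T)))
    (hV1 : ∀ t ∈ Icc 0 T, ‖V t‖ ≤ 1) (hVs : ∀ t ∈ Icc 0 T, star (V t) = V t)
    (hU : ContinuousOn U (Icc 0 T))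
    (hint : ∀ t ∈ Icc 0 T, U t = 1 - Complex.I • ∫ s in (0 : ℝ)..t, V s * U s)
    {s t : ℝ} (hs : s ∈ Icc 0 T) (ht : t ∈ Icc 0 T) :
    ‖U t - U s‖ ≤ |t - s| := by
  rw [← one_mul |t - s|]
  refine norm_sub_le_mul_of_norm_le hV hV1 hU hint (fun r hr => ?_) hs ht
  have h1 := CStarRing.norm_star_mul_self (x := U r)
  rw [star_mul_self_eq_one_of_integral_eq hV hV1 hVs hU hint r hr] at h1
  have h2 : ‖(1 : A)‖ ≤ 1 := by
    rcases subsingleton_or_nontrivial A with h | h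
    · simp [Subsingleton.elim (1 : A) 0]
    · exact CStarRing.norm_one.le
  nlinarith [norm_nonneg (U r)]

end Propagator

/-! ### Angles swept by curves on the unit sphere. -/

section Angle

variable {E : Type*} [NormedAddCommGroup E] [InnerProductSpace ℝ E]

/-- The chord of an angle `α` on the unit sphere has length `2 sin (α / 2)`. -/
theorem angle_le_two_mul_arcsin {x y : E} (hx : ‖x‖ = 1) (hy : ‖y‖ = 1) {d : ℝ}
    (hd : ‖x - y‖ ≤ d) : InnerProductGeometry.angle x y ≤ 2 * Real.arcsin (d / 2) := by
  set α := InnerProductGeometry.angle x y with hα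
  have h0 : 0 ≤ α := InnerProductGeometry.angle_nonneg x y
  have hpi : α ≤ Real.pi := InnerProductGeometry.angle_le_pi x y
  have hcos : inner ℝ x y = Real.cos α := by
    have := InnerProductGeometry.cos_angle_mul_norm_mul_norm x y
    rw [hx, hy] at this
    rw [← this]; ring
  have hsq : ‖x - y‖ ^ 2 = (2 * Real.sin (α / 2)) ^ 2 := by
    rw [norm_sub_sq_real, hx, hy, hcos, mul_pow, Real.sin_sq_eq_half_sub]
    ring_nf
  have hs0 : 0 ≤ Real.sin (α / 2) :=
    Real.sin_nonneg_of_nonneg_of_le_pi (by linarith) (by linarith)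
  have heq : ‖x - y‖ = 2 * Real.sin (α / 2) :=
    (pow_left_inj₀ (norm_nonneg _) (by positivity) two_ne_zero).1 hsq
  have h1 : Real.arcsin (Real.sin (α / 2)) ≤ Real.arcsin (d / 2) :=
    Real.monotone_arcsin (by linarith)
  rw [Real.arcsin_sin (by linarith) (by linarith)] at h1
  linarith

theorem angle_le_sum_angle (x : ℕ → E) (N : ℕ) (h : x 0 ≠ 0) :
    InnerProductGeometry.angle (x 0) (x N) ≤
      ∑ k ∈ Finset.range N, InnerProductGeometry.angle (x k) (x (k + 1)) := by
  induction N with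
  | zero => simp [InnerProductGeometry.angle_self h]
  | succ N ih =>
    rw [Finset.sum_range_succ]
    exact (InnerProductGeometry.angle_le_angle_add_angle _ (x N) _).trans (by linarith)

/-- A curve on the unit sphere of speed at most one sweeps an angle of at most its duration. -/
theorem angle_le_of_norm_sub_le {ψ : ℝ → E} {T : ℝ} (hT : 0 ≤ T)
    (h1 : ∀ t ∈ Icc 0 T, ‖ψ t‖ = 1)
    (hL : ∀ s ∈ Icc 0 T, ∀ t ∈ Icc 0 T, ‖ψ s - ψ t‖ ≤ |s - t|) :
    InnerProductGeometry.angle (ψ 0) (ψ T) ≤ T := by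
  -- Cut `[0, T]` into `N` equal pieces, bound each angle through its chord of length at most `T /
  -- N`, and add up by the triangle inequality for angles.
  have hN : ∀ N : ℕ, 0 < N → InnerProductGeometry.angle (ψ 0) (ψ T) ≤
      N * (2 * Real.arcsin (T / N / 2)) := by
    intro N hN
    have hN' : (0 : ℝ) < N := by exact_mod_cast hN
    have hmem : ∀ k : ℕ, k ≤ N → (k : ℝ) * (T / N) ∈ Icc 0 T := by
      intro k hk
      have hk' : (k : ℝ) ≤ N := by exact_mod_cast hk
      refine ⟨by positivity, ?_⟩
      calc (k : ℝ) * (T / N) ≤ N * (T / N) := by gcongr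
        _ = T := by field_simp
    have h00 : ‖ψ 0‖ = 1 := h1 0 ⟨le_rfl, hT⟩
    have h := angle_le_sum_angle (fun k : ℕ => ψ (k * (T / N))) N (by
      simp only [Nat.cast_zero, zero_mul]
      intro h; simp [h] at h00)
    have hNT : (N : ℝ) * (T / N) = T := by field_simp
    simp only [Nat.cast_zero, zero_mul, hNT] at h
    refine h.trans ((Finset.sum_le_card_nsmul _ _ (2 * Real.arcsin (T / N / 2)) ?_).trans ?_)
    · intro k hk
      have hk' := Finset.mem_range.1 hk
      have m1 := hmem k hk'.le
      have m2 := hmem (k + 1) hk'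
      refine angle_le_two_mul_arcsin (h1 _ m1) (h1 _ m2) ((hL _ m1 _ m2).trans ?_)
      have : (k : ℝ) * (T / N) - ((k + 1 : ℕ) : ℝ) * (T / N) = -(T / N) := by push_cast; ring
      rw [this, abs_neg, abs_of_nonneg (by positivity)]
    · simp
  have hlim : Tendsto (fun N : ℕ => (N : ℝ) * (2 * Real.arcsin (T / N / 2))) atTop (𝓝 T) := by
    -- With `h = 1 / N`, the bound is a difference quotient of this function at 0.
    have hd : HasDerivAt (fun h : ℝ => 2 * Real.arcsin (T * h / 2)) T 0 := by
      have h1 : HasDerivAt (fun h : ℝ => T * h / 2) (T / 2) 0 := by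
        simpa using ((hasDerivAt_id (0 : ℝ)).const_mul T).div_const 2
      have h2 : HasDerivAt Real.arcsin 1 (T * 0 / 2) := by
        simpa using Real.hasDerivAt_arcsin (x := 0) (by norm_num) (by norm_num)
      have h3 := (h2.comp 0 h1).const_mul 2
      exact h3.congr_deriv (by ring)
    have h4 := hd.tendsto_slope_zero
    have h5 : Tendsto (fun N : ℕ => ((N : ℝ))⁻¹) atTop (𝓝[≠] 0) := by
      refine tendsto_nhdsWithin_iff.2 ⟨tendsto_inv_atTop_nhds_zero_nat, ?_⟩
      filter_upwards [eventually_gt_atTop 0] with N hN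
      have : (N : ℝ) ≠ 0 := by exact_mod_cast hN.ne'
      simpa using hN.ne'
    have h6 := h4.comp h5
    refine h6.congr fun N => ?_
    simp [div_eq_mul_inv]
  refine ge_of_tendsto hlim ?_
  filter_upwards [eventually_gt_atTop 0] with N hN0 using hN N hN0

end Angle

/-! ### Trace norm, fidelity and the overlap `tr (ρ U)`. -/

section Trace
open scoped ComplexOrder MatrixOrder

variable {n : Type*} [Fintype n] [DecidableEq n]

theorem trace_eq_sum_inner (M : Matrix n n ℂ) (b : OrthonormalBasis n ℂ (EuclideanSpace ℂ n)) :
    M.trace = ∑ i, inner ℂ (b i) (Matrix.toEuclideanLin M (b i)) := by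
  rw [← LinearMap.trace_eq_sum_inner]
  exact (Matrix.trace_toLin_eq M (EuclideanSpace.basisFun n ℂ).toBasis).symm

theorem inner_toEuclideanLin_conjTranspose (M : Matrix n n ℂ) (x y : EuclideanSpace ℂ n) :
    inner ℂ x (Matrix.toEuclideanLin M.conjTranspose y) =
      inner ℂ (Matrix.toEuclideanLin M x) y := by
  rw [Matrix.toEuclideanLin_conjTranspose_eq_adjoint, LinearMap.adjoint_inner_right]

theorem toEuclideanLin_mul_apply (M N : Matrix n n ℂ) (x : EuclideanSpace ℂ n) :
    Matrix.toEuclideanLin (M * N) x = Matrix.toEuclideanLin M (Matrix.toEuclideanLin N x) := by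
  simp [Matrix.toLpLin_apply, Matrix.mulVec_mulVec]

theorem toEuclideanLin_eigenvectorBasis {M : Matrix n n ℂ} (hM : M.IsHermitian) (i : n) :
    Matrix.toEuclideanLin M (hM.eigenvectorBasis i) =
      (hM.eigenvalues i : ℂ) • hM.eigenvectorBasis i := by
  ext j
  simpa [Matrix.toLpLin_apply] using congrFun (hM.mulVec_eigenvectorBasis i) j

/-- The real part of the trace is at most the trace norm. -/
theorem re_trace_le_re_trace_sqrt (N : Matrix n n ℂ) :
    N.trace.re ≤ (CFC.sqrt (N.conjTranspose * N)).trace.re := by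
  set P := CFC.sqrt (N.conjTranspose * N) with hP
  have hPp : P.PosSemidef := Matrix.nonneg_iff_posSemidef.1 (CFC.sqrt_nonneg _)
  have hPP : P * P = N.conjTranspose * N :=
    CFC.sqrt_mul_sqrt_self _ (Matrix.posSemidef_conjTranspose_mul_self N).nonneg
  have hH : P.IsHermitian := hPp.1
  -- Both traces are computed in an eigenbasis of `P = |N|`. Since `‖N e‖ = ‖P e‖` is the eigenvalue
  -- at `e`, Cauchy–Schwarz compares the sums term by term.
  rw [trace_eq_sum_inner N hH.eigenvectorBasis, hH.trace_eq_sum_eigenvalues, Complex.re_sum,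
    Complex.re_sum]
  refine Finset.sum_le_sum fun i _ => ?_
  set e := hH.eigenvectorBasis i with he
  have he1 : ‖e‖ = 1 := hH.eigenvectorBasis.orthonormal.1 i
  have hl : 0 ≤ hH.eigenvalues i := hPp.eigenvalues_nonneg i
  have h1 : ‖Matrix.toEuclideanLin N e‖ = ‖Matrix.toEuclideanLin P e‖ := by
    have h2 : inner ℂ (Matrix.toEuclideanLin N e) (Matrix.toEuclideanLin N e) =
        inner ℂ (Matrix.toEuclideanLin P e) (Matrix.toEuclideanLin P e) := by
      rw [← inner_toEuclideanLin_conjTranspose, ← inner_toEuclideanLin_conjTranspose,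
        ← toEuclideanLin_mul_apply, ← toEuclideanLin_mul_apply, hH.eq, hPP]
    rw [inner_self_eq_norm_sq_to_K, inner_self_eq_norm_sq_to_K] at h2
    exact (pow_left_inj₀ (norm_nonneg _) (norm_nonneg _) two_ne_zero).1 (by exact_mod_cast h2)
  have h3 : ‖Matrix.toEuclideanLin P e‖ = hH.eigenvalues i := by
    rw [he, toEuclideanLin_eigenvectorBasis hH, norm_smul, ← he, he1, mul_one, Complex.norm_real,
      Real.norm_of_nonneg hl]
  calc (inner ℂ e (Matrix.toEuclideanLin N e)).re
      ≤ ‖inner ℂ e (Matrix.toEuclideanLin N e)‖ := Complex.re_le_norm _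
    _ ≤ ‖e‖ * ‖Matrix.toEuclideanLin N e‖ := norm_inner_le_norm _ _
    _ = hH.eigenvalues i := by rw [he1, one_mul, h1, h3]
    _ = _ := by simp

theorem fidelity_nonneg (ρ σ : Matrix n n ℂ) : 0 ≤ fidelity ρ σ :=
  (Complex.nonneg_iff.1 (Matrix.nonneg_iff_posSemidef.1
    (CFC.sqrt_nonneg (CFC.sqrt ρ * σ * CFC.sqrt ρ))).trace_nonneg).1

/-- The real part of the overlap `tr (ρ U)` is a lower bound of the fidelity of `ρ` and
`U ρ U†`. -/
theorem re_trace_mul_le_fidelity {ρ : Matrix n n ℂ} (hρ : ρ.PosSemidef) (U : Matrix n n ℂ) :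
    (ρ * U).trace.re ≤ fidelity ρ (U * ρ * U.conjTranspose) := by
  set S := CFC.sqrt ρ with hS
  have hSH : S.conjTranspose = S := (Matrix.nonneg_iff_posSemidef.1 (CFC.sqrt_nonneg ρ)).1
  have hSS : S * S = ρ := CFC.sqrt_mul_sqrt_self _ hρ.nonneg
  -- For `N = √ρ U† √ρ`, the product `N† N` is exactly the matrix under the root in the fidelity.
  have h := re_trace_le_re_trace_sqrt (S * U.conjTranspose * S)
  have h1 : (S * U.conjTranspose * S).conjTranspose * (S * U.conjTranspose * S) =
      S * (U * ρ * U.conjTranspose) * S := by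
    simp only [Matrix.conjTranspose_mul, Matrix.conjTranspose_conjTranspose, hSH, ← hSS,
      Matrix.mul_assoc]
  rw [h1] at h
  refine le_trans (le_of_eq ?_) h
  have h2 : S * U.conjTranspose * S = (S * U * S).conjTranspose := by
    simp only [Matrix.conjTranspose_mul, hSH, Matrix.mul_assoc]
  rw [h2, Matrix.trace_conjTranspose, Matrix.trace_mul_comm (S * U) S, ← Matrix.mul_assoc, hSS]
  simp

/-- In an eigenbasis of `ρ`, the trace is a convex combination of the numbers `⟨v, U v⟩`, weighted
by the eigenvalues of `ρ`. -/
theorem le_re_trace_mul {ρ : Matrix n n ℂ} (hρ : IsDensityMatrix ρ) {U : Matrix n n ℂ} {c : ℝ}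
    (hU : ∀ v : EuclideanSpace ℂ n, ‖v‖ = 1 → c ≤ (inner ℂ v (Matrix.toEuclideanLin U v)).re) :
    c ≤ (ρ * U).trace.re := by
  have hH := hρ.posSemidef.1
  have htr : ∑ i, hH.eigenvalues i = 1 := by
    have := hρ.trace_eq_one
    rw [hH.trace_eq_sum_eigenvalues] at this
    simpa using congrArg Complex.re this
  rw [Matrix.trace_mul_comm, trace_eq_sum_inner _ hH.eigenvectorBasis, Complex.re_sum]
  calc c = ∑ i, hH.eigenvalues i * c := by rw [← Finset.sum_mul, htr, one_mul]
    _ ≤ _ := Finset.sum_le_sum fun i _ => ?_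
  rw [toEuclideanLin_mul_apply, toEuclideanLin_eigenvectorBasis, map_smul, inner_smul_right,
    Complex.re_ofReal_mul]
  exact mul_le_mul_of_nonneg_left (hU _ (hH.eigenvectorBasis.orthonormal.1 i))
    (hρ.posSemidef.eigenvalues_nonneg i)

end Trace

/-! ### Every charging time bounds the Bures angle. -/

section LowerBound
open scoped Matrix.Norms.L2Operator

variable {n : Type*} [Fintype n] [DecidableEq n]

theorem norm_toEuclideanLin_le (M : Matrix n n ℂ) (v : EuclideanSpace ℂ n) :
    ‖Matrix.toEuclideanLin M v‖ ≤ ‖M‖ * ‖v‖ :=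
  M.l2_opNorm_mulVec v

theorem cos_le_re_inner_propagator {T : ℝ} (hT : 0 ≤ T) (hTpi : T ≤ Real.pi)
    {V U : ℝ → Matrix n n ℂ} (hV : IsChargingHamiltonian T V) (hU : IsPropagator T V U)
    {v : EuclideanSpace ℂ n} (hv : ‖v‖ = 1) :
    Real.cos T ≤ (inner ℂ v (Matrix.toEuclideanLin (U T) v)).re := by
  have h0 : U 0 = 1 := by simpa using hU.eq_integral 0 ⟨le_rfl, hT⟩
  have hV1 : ∀ t ∈ Icc 0 T, ‖V t‖ ≤ 1 := fun t ht => (hV.norm_eq_one t ht).le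
  have hVs : ∀ t ∈ Icc 0 T, star (V t) = V t := fun t ht => hV.isHermitian t ht
  set ψ : ℝ → EuclideanSpace ℂ n := fun t => Matrix.toEuclideanLin (U t) v with hψ
  have hψ0 : ψ 0 = v := by simp [hψ, h0, Matrix.toLpLin_apply]
  have hn : ∀ t ∈ Icc 0 T, ‖ψ t‖ = 1 := by
    intro t ht
    have hu := star_mul_self_eq_one_of_integral_eq hV.aestronglyMeasurable hV1 hVs
      hU.continuousOn hU.eq_integral t ht
    rw [Matrix.star_eq_conjTranspose] at hu
    have h2 : inner ℂ (ψ t) (ψ t) = inner ℂ v v := by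
      rw [hψ, ← inner_toEuclideanLin_conjTranspose, ← toEuclideanLin_mul_apply, hu]
      simp
    rw [inner_self_eq_norm_sq_to_K, inner_self_eq_norm_sq_to_K, hv] at h2
    exact (pow_left_inj₀ (norm_nonneg _) zero_le_one two_ne_zero).1 (by exact_mod_cast h2)
  have hL : ∀ s ∈ Icc 0 T, ∀ t ∈ Icc 0 T, ‖ψ s - ψ t‖ ≤ |s - t| := by
    intro s hs t ht
    have h1 : ψ s - ψ t = Matrix.toEuclideanLin (U s - U t) v := by simp [hψ]
    rw [h1]
    refine (norm_toEuclideanLin_le _ _).trans ?_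
    rw [hv, mul_one]
    exact norm_sub_le_abs_sub_of_integral_eq hV.aestronglyMeasurable hV1 hVs
      hU.continuousOn hU.eq_integral ht hs
  have hang := angle_le_of_norm_sub_le hT hn hL
  rw [hψ0] at hang
  have hcos := Real.cos_le_cos_of_nonneg_of_le_pi (InnerProductGeometry.angle_nonneg _ _) hTpi hang
  rw [InnerProductGeometry.cos_angle, hv, hn T ⟨hT, le_rfl⟩, one_mul, div_one] at hcos
  refine hcos.trans (le_of_eq ?_)
  -- The angle was measured in the real inner product, which coordinatewise is the real part of the
  -- complex one.
  rw [PiLp.inner_apply, PiLp.inner_apply, Complex.re_sum]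
  exact Finset.sum_congr rfl fun i _ => real_inner_eq_re_inner ℂ (v i) (ψ T i)

theorem buresAngle_le_of_mem_chargingTimes {ρ σ : Matrix n n ℂ} (hρ : IsDensityMatrix ρ) {T : ℝ}
    (hT : T ∈ chargingTimes ρ σ) : buresAngle ρ σ ≤ T := by
  obtain ⟨hT0, V, U, hV, hU, rfl⟩ := hT
  -- Beyond `π / 2` the bound is automatic: the fidelity is nonnegative, so its arccosine is at most
  -- `π / 2`.
  rcases le_total T (Real.pi / 2) with h | h
  · have hpi : T ≤ Real.pi := h.trans (by linarith [Real.pi_pos])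
    refine le_trans ?_ (Real.arccos_cos hT0 hpi).le
    refine Real.arccos_le_arccos ((le_re_trace_mul hρ fun v hv => ?_).trans
      (re_trace_mul_le_fidelity hρ.posSemidef (U T)))
    exact cos_le_re_inner_propagator hT0 hpi hV hU hv
  · exact (Real.arccos_le_pi_div_two.2 (fidelity_nonneg _ _)).trans h

end LowerBound

/-! ### Existence of a charging time for isospectral states. -/

section Nonempty
open scoped Matrix.Norms.L2Operator

variable {n : Type*} [Fintype n] [DecidableEq n]

/-- Both characteristic polynomials are monic and split, so their roots determine them, and the
indexed eigenvalues agree. Both matrices thus diagonalise to the same `D`, and `W = Q P*` matches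
the eigenbases. -/
theorem exists_unitary_conj_of_roots_charpoly_eq {ρ σ : Matrix n n ℂ} (hρ : ρ.IsHermitian)
    (hσ : σ.IsHermitian) (h : ρ.charpoly.roots = σ.charpoly.roots) :
    ∃ W ∈ unitary (Matrix n n ℂ), σ = W * ρ * W.conjTranspose := by
  have hchar : ρ.charpoly = σ.charpoly := by
    rw [hρ.splits_charpoly.eq_prod_roots_of_monic ρ.charpoly_monic,
      hσ.splits_charpoly.eq_prod_roots_of_monic σ.charpoly_monic, h]
  have heig := (hρ.eigenvalues_eq_eigenvalues_iff hσ).2 hchar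
  set P := hρ.eigenvectorUnitary with hP
  set Q := hσ.eigenvectorUnitary with hQ
  refine ⟨(Q : Matrix n n ℂ) * star (P : Matrix n n ℂ), (Q * star P).2, ?_⟩
  have h1 := hρ.spectral_theorem
  have h2 := hσ.spectral_theorem
  rw [Unitary.conjStarAlgAut_apply] at h1 h2
  rw [← heig] at h2
  have h3 : (star (P : Matrix n n ℂ)) * P = 1 := Unitary.coe_star_mul_self P
  generalize Matrix.diagonal ((RCLike.ofReal : ℝ → ℂ) ∘ hρ.eigenvalues) = D at h1 h2
  rw [← hP] at h1
  rw [← hQ] at h2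
  conv_lhs => rw [h2]
  conv_rhs => rw [h1]
  have h4 : ∀ X : Matrix n n ℂ, star (P : Matrix n n ℂ) * (P * X) = X := fun X => by
    rw [← mul_assoc, h3, one_mul]
  simp only [← Matrix.star_eq_conjTranspose, star_mul, star_star, mul_assoc, h4]

/-- Take `H = -arg W` by functional calculus. The spectrum is finite, so the branch cut of `arg`
does not spoil continuity, and it lies on the unit circle, where `z = exp (i arg z)`. -/
theorem exists_isHermitian_exp_eq {W : Matrix n n ℂ} (hW : W ∈ unitary (Matrix n n ℂ)) :
    ∃ H : Matrix n n ℂ, H.IsHermitian ∧ NormedSpace.exp (-(Complex.I • H)) = W := by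
  have hfin : (spectrum ℂ W).Finite := Module.End.finite_spectrum (Matrix.toLin' W) |>.subset (by
    rw [Matrix.spectrum_toLin'])
  have hWn : IsStarNormal W := by
    constructor
    rw [Commute, SemiconjBy, (Unitary.mem_iff.1 hW).1, (Unitary.mem_iff.1 hW).2]
  have hc : ∀ f : ℂ → ℂ, ContinuousOn f (spectrum ℂ W) := fun f => hfin.continuousOn f
  refine ⟨cfc (fun z : ℂ => ((-z.arg : ℝ) : ℂ)) W, ?_, ?_⟩
  · rw [Matrix.IsHermitian, ← Matrix.star_eq_conjTranspose, ← cfc_star]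
    simp
  · rw [← cfc_smul _ _ _ (hc _), ← cfc_neg, ← CFC.exp_eq_normedSpace_exp (𝕜 := ℂ)
      (cfc_predicate _ _), ← cfc_comp' _ _ _ (hfin.image _ |>.continuousOn _) (hc _)]
    conv_rhs => rw [← cfc_id' ℂ W]
    refine cfc_congr fun z hz => ?_
    have h1 : ‖z‖ = 1 := spectrum.norm_eq_one_of_unitary hW hz
    have h2 := Complex.norm_mul_exp_arg_mul_I z
    rw [h1, Complex.ofReal_one, one_mul] at h2
    conv_rhs => rw [← h2]
    rw [← Complex.exp_eq_exp_ℂ]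
    congr 1
    push_cast
    simp [mul_comm]

theorem isPropagator_exp (T : ℝ) (K : Matrix n n ℂ) :
    IsPropagator T (fun _ => K) (fun t => NormedSpace.exp (t • -(Complex.I • K))) := by
  have hd : ∀ t : ℝ, HasDerivAt (fun t : ℝ => NormedSpace.exp (t • -(Complex.I • K)))
      (-(Complex.I • K) * NormedSpace.exp (t • -(Complex.I • K))) t :=
    fun t => hasDerivAt_exp_smul_const' _ t
  have hcont : Continuous (fun t : ℝ => NormedSpace.exp (t • -(Complex.I • K))) :=
    continuous_iff_continuousAt.2 fun t => (hd t).continuousAt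
  refine ⟨hcont.continuousOn, fun t _ => ?_⟩
  have hi := intervalIntegral.integral_eq_sub_of_hasDerivAt (a := 0) (b := t) (fun s _ => hd s)
    ((continuous_const.mul hcont).intervalIntegrable _ _)
  simp only [neg_mul, smul_mul_assoc, intervalIntegral.integral_neg,
    intervalIntegral.integral_smul, zero_smul, NormedSpace.exp_zero] at hi
  rw [sub_eq_add_neg, hi]
  abel

/-- Writing the conjugating unitary as `exp (-iH)` and `H = ‖H‖ K` with `‖K‖ = 1`, the constant
Hamiltonian `K` does the job in time `‖H‖`. -/
theorem chargingTimes_nonempty {ρ σ : Matrix n n ℂ} (hρ : IsDensityMatrix ρ)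
    (hσ : IsDensityMatrix σ) (h : SameSpectrum ρ σ) : (chargingTimes ρ σ).Nonempty := by
  -- Trace one excludes the zero algebra, so `‖1‖ = 1`. This matters when `H = 0`: the duration is
  -- 0, yet a Hamiltonian of norm one is still required at time 0.
  have hne : Nontrivial (Matrix n n ℂ) := by
    refine ⟨ρ, 0, fun h0 => ?_⟩
    have := hρ.trace_eq_one
    simp [h0] at this
  obtain ⟨W, hW, hconj⟩ :=
    exists_unitary_conj_of_roots_charpoly_eq hρ.posSemidef.1 hσ.posSemidef.1 h
  obtain ⟨H, hH, hexp⟩ := exists_isHermitian_exp_eq hW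
  obtain ⟨K, hK, hK1, hHK⟩ : ∃ K : Matrix n n ℂ, K.IsHermitian ∧ ‖K‖ = 1 ∧ H = ‖H‖ • K := by
    rcases eq_or_ne H 0 with rfl | h0
    · exact ⟨1, Matrix.isHermitian_one, CStarRing.norm_one, by simp⟩
    · have h0' : ‖H‖ ≠ 0 := norm_ne_zero_iff.2 h0
      refine ⟨‖H‖⁻¹ • H, ?_, ?_, ?_⟩
      · rw [Matrix.IsHermitian, Matrix.conjTranspose_smul, hH.eq]
        simp
      · rw [norm_smul, norm_inv, norm_norm, inv_mul_cancel₀ h0']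
      · rw [smul_smul, mul_inv_cancel₀ h0', one_smul]
  refine ⟨‖H‖, norm_nonneg H, fun _ => K, _,
    ⟨aestronglyMeasurable_const, fun _ _ => hK, fun _ _ => hK1⟩, isPropagator_exp _ K, ?_⟩
  have h1 : ‖H‖ • -(Complex.I • K) = -(Complex.I • H) := by
    conv_rhs => rw [hHK]
    rw [smul_neg, smul_comm]
  simp only [h1, hexp]
  exact hconj

end Nonempty
end QuantumCharging

theorem theorem6 {n : Type*} [Fintype n] [DecidableEq n] (ρ σ : Matrix n n ℂ)
    (hρ : QuantumCharging.IsDensityMatrix ρ) (hσ : QuantumCharging.IsDensityMatrix σ)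
    (hspec : QuantumCharging.SameSpectrum ρ σ) :
    QuantumCharging.buresAngle ρ σ ≤ QuantumCharging.chargingDistance ρ σ :=
  le_csInf (QuantumCharging.chargingTimes_nonempty hρ hσ hspec)
    fun _ hT => QuantumCharging.buresAngle_le_of_mem_chargingTimes hρ hT
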